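/- Let $M,N\ge 1$ and $q\ge 0$ be integers (the number of explorations per cycle; the main case is $q=3$), let $\mathbf{s}$ be a complex pilot vector and $\sigma_z>0$. For a parameter vector $\boldsymbol\psi=[\beta^{\mathrm{re}},\beta^{\mathrm{im}},x_1,x_2]^{\mathrm T}\in\mathbb{R}^4$ put $\beta=\beta^{\mathrm{re}}+j\beta^{\mathrm{im}}$, let $\mathbf{a}(\mathbf{x})=\mathbf{a}_1(x_1)\otimes\mathbf{a}_2(x_2)\in\mathbb{C}^{MN}$ with $\mathbf{a}_1(x_1)=[e^{j2\pi\frac{m}{M}x_1}]_{m=0}^{M-1}$ and $\mathbf{a}_2(x_2)=[e^{j2\pi\frac{n}{N}x_2}]_{n=0}^{N-1}$, and let $\mathbf{h}(\boldsymbol\psi)=\beta\,\mathbf{a}(\mathbf{x})$ be the channel vector. Given a beamforming matrix $\mathbf{W}\in\mathbb{C}^{MN\times q}$, an observation $\mathbf{y}\in\mathbb{C}^q$ has the $\mathcal{CN}(|\mathbf{s}|\beta\mathbf{W}^{\mathrm H}\mathbf{a}(\mathbf{x}),\sigma_z^2\mathbf{J}_q)$ density $$p_S(\mathbf{y}\mid\boldsymbol\psi,\mathbf{W})=\frac{1}{\pi^q\sigma_z^{2q}}\exp\Bigl(-\frac{\|\mathbf{y}-|\mathbf{s}|\beta\mathbf{W}^{\mathrm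 H}\mathbf{a}(\mathbf{x})\|_2^2}{\sigma_z^2}\Bigr).$$ Fix $\boldsymbol\psi$ (quasi-static case: $\boldsymbol\psi$ is the same in all cycles). (i) The Jacobian matrix $\mathbf{V}=\partial\mathbf{h}/\partial\boldsymbol\psi^{\mathrm T}$ at $\boldsymbol\psi$ equals $\left[\mathbf{a}(\mathbf{x}),\,j\mathbf{a}(\mathbf{x}),\,\beta\frac{\partial\mathbf{a}(\mathbf{x})}{\partial x_1},\,\beta\frac{\partial\mathbf{a}(\mathbf{x})}{\partial x_2}\right]$. (ii) For every $\mathbf{W}\in\mathbb{C}^{MN\times q}$ the Fisher information matrix exists and satisfies $$\mathbf{I}_S(\boldsymbol\psi,\mathbf{W})\triangleq\mathbb{E}\left[\frac{\partial\log p_S(\mathbf{y}|\boldsymbol\psi,\mathbf{W})}{\partial\boldsymbol\psi}\cdot\frac{\partial\log p_S(\mathbf{y}|\boldsymbol\psi,\mathbf{W})}{\partial\boldsymbol\psi^{\mathrm T}}\right]=\frac{2|\mathbf{s}|^2}{\sigma_z^2}\,\mathrm{Re}\{\mathbf{V}^{\mathrm H}\mathbf{W}\mathbf{W}^{\mathrm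 H}\mathbf{V}\}.$$ (iii) Let $\mathbf{W}_1,\dots,\mathbf{W}_k\in\mathbb{C}^{MN\times q}$ be given (fixed) beamforming matrices such that $\sum_{l=1}^k\mathbf{I}_S(\boldsymbol\psi,\mathbf{W}_l)$ is invertible, and let $\mathbf{y}_1,\dots,\mathbf{y}_k$ be independent, $\mathbf{y}_l$ with density $p_S(\cdot\mid\boldsymbol\psi,\mathbf{W}_l)$. Then $$C_S^t(\boldsymbol\psi,\mathbf{W}_1,\dots,\mathbf{W}_k)\triangleq\frac{1}{MN}\mathrm{Tr}\Bigl\{\Bigl(\sum_{l=1}^k\mathbf{I}_S(\boldsymbol\psi,\mathbf{W}_l)\Bigr)^{-1}\mathbf{V}^{\mathrm H}\mathbf{V}\Bigr\}$$ is real, and every estimate $\hat{\mathbf{h}}_k=\hat{\mathbf{h}}_k(\mathbf{y}_1,\dots,\mathbf{y}_k)\in\mathbb{C}^{MN}$ of the channel vector (in particular every one of the form $\hat\beta_k\mathbf{a}(\hat{\mathbf{x}}_k)$) that is unbiased, i.e. $\mathbb{E}[\hat{\mathbf{h}}_k]=\mathbf{h}(\boldsymbol\psi')$ under each true parameter $\boldsymbol\psi'$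 in some neighbourhood of $\boldsymbol\psi$, satisfies $$\frac{1}{MN}\mathbb{E}\bigl[\|\hat{\mathbf{h}}_k-\mathbf{h}(\boldsymbol\psi)\|_2^2\bigr]\ \ge\ C_S^t(\boldsymbol\psi,\mathbf{W}_1,\dots,\mathbf{W}_k),$$ where the expectation is taken under $\boldsymbol\psi$ and may be $+\infty$. -/

import Mathlib

open MeasureTheory

namespace BeamTracking

/-- The channel parameter vector `ψ = (Re β, Im β, x₁, x₂)`. -/
abbrev Param : Type := Fin 4 → ℝ

/-- The complex channel gain `β` of a parameter vector. -/
noncomputable def gain (ψ : Param) : ℂ := (ψ 0 : ℂ) + (ψ 1 : ℂ) * Complex.I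

/-- The one-dimensional steering vector of an array with `n` elements:
its entries are `exp (j 2π (m / n) t)` for `m = 0, …, n - 1`. -/
noncomputable def steering1 (n : ℕ) (t : ℝ) (m : Fin n) : ℂ :=
  Complex.exp (2 * Real.pi * Complex.I * (((m : ℕ) : ℂ) / (n : ℂ)) * (t : ℂ))

/-- The two-dimensional steering vector `a(x) = a₁(x₁) ⊗ a₂(x₂)`; the entries of the Kronecker
product of two vectors are indexed by pairs. -/
noncomputable def steering (M N : ℕ) (x₁ x₂ : ℝ) (p : Fin M × Fin N) : ℂ :=
  steering1 M x₁ p.1 * steering1 N x₂ p.2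

/-- The channel vector `h(ψ) = β a(x)`. -/
noncomputable def channel (M N : ℕ) (ψ : Param) (p : Fin M × Fin N) : ℂ :=
  gain ψ * steering M N (ψ 2) (ψ 3) p

/-- The Jacobian matrix `V = ∂h / ∂ψᵀ` at `ψ`. -/
noncomputable def jacobian (M N : ℕ) (ψ : Param) : Matrix (Fin M × Fin N) (Fin 4) ℂ :=
  Matrix.of fun p i => fderiv ℝ (fun φ : Param => channel M N φ p) ψ (Pi.single i 1)

/-- The mean `|s| β Wᴴ a(x)` of an observation vector; `r = |s|`, and the columns of `W` are
the `q` beamforming vectors. -/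
noncomputable def obsMean {M N q : ℕ} (r : ℝ) (W : Matrix (Fin M × Fin N) (Fin q) ℂ)
    (ψ : Param) : Fin q → ℂ :=
  (r : ℂ) • (W.conjTranspose.mulVec (channel M N ψ))

/-- The density `p_S(y | ψ, W)` of an observation vector `y ∼ CN(|s| β Wᴴ a(x), σ² I_q)`. -/
noncomputable def obsDensity {M N q : ℕ} (r σ : ℝ) (W : Matrix (Fin M × Fin N) (Fin q) ℂ)
    (ψ : Param) (y : Fin q → ℂ) : ℝ :=
  1 / (Real.pi ^ q * σ ^ (2 * q)) *
    Real.exp (-(∑ i, ‖y i - obsMean r W ψ i‖ ^ 2) / σ ^ 2)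

/-- The law of an observation vector, on `ℂ^q` with its Lebesgue measure. -/
noncomputable def obsLaw {M N q : ℕ} (r σ : ℝ) (W : Matrix (Fin M × Fin N) (Fin q) ℂ)
    (ψ : Param) : Measure (Fin q → ℂ) :=
  (volume : Measure (Fin q → ℂ)).withDensity fun y => ENNReal.ofReal (obsDensity r σ W ψ y)

/-- The joint law of the independent observation vectors `y₁, …, y_k`. -/
noncomputable def jointLaw {M N q k : ℕ} (r σ : ℝ)
    (W : Fin k → Matrix (Fin M × Fin N) (Fin q) ℂ) (ψ : Param) :
    Measure (Fin k → Fin q → ℂ) :=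
  Measure.pi fun l => obsLaw r σ (W l) ψ

/-- The score `∂ log p_S(y | ψ, W) / ∂ψ`. -/
noncomputable def score {M N q : ℕ} (r σ : ℝ) (W : Matrix (Fin M × Fin N) (Fin q) ℂ)
    (ψ : Param) (y : Fin q → ℂ) (i : Fin 4) : ℝ :=
  fderiv ℝ (fun φ : Param => Real.log (obsDensity r σ W φ y)) ψ (Pi.single i 1)

/-- The Fisher information matrix `I_S(ψ, W) = E[∂ log p_S / ∂ψ · ∂ log p_S / ∂ψᵀ]`. -/
noncomputable def fisher {M N q : ℕ} (r σ : ℝ) (W : Matrix (Fin M × Fin N) (Fin q) ℂ)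
    (ψ : Param) : Matrix (Fin 4) (Fin 4) ℝ :=
  Matrix.of fun i j => ∫ y, score r σ W ψ y i * score r σ W ψ y j ∂(obsLaw r σ W ψ)

/-- The estimate `g(y₁, …, y_k)` of the channel vector is unbiased when the true parameter
vector is `ψ`: its expectation exists and equals `h(ψ)`. -/
def UnbiasedAt {M N q k : ℕ} (r σ : ℝ) (W : Fin k → Matrix (Fin M × Fin N) (Fin q) ℂ)
    (g : (Fin k → Fin q → ℂ) → Fin M × Fin N → ℂ) (ψ : Param) : Prop :=
  ∀ p, Integrable (fun y => g y p) (jointLaw r σ W ψ) ∧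
    ∫ y, g y p ∂(jointLaw r σ W ψ) = channel M N ψ p

/-- The normalized mean square error `(1 / MN) E‖g(y₁, …, y_k) - h(ψ)‖²` of an estimate of the
channel vector, as an extended nonnegative number. -/
noncomputable def mse {M N q k : ℕ} (r σ : ℝ) (W : Fin k → Matrix (Fin M × Fin N) (Fin q) ℂ)
    (g : (Fin k → Fin q → ℂ) → Fin M × Fin N → ℂ) (ψ : Param) : ENNReal :=
  ENNReal.ofReal (1 / ((M : ℝ) * (N : ℝ))) *
    ∫⁻ y, ENNReal.ofReal (∑ p, ‖g y p - channel M N ψ p‖ ^ 2) ∂(jointLaw r σ W ψ)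

/-- The bound `(1 / MN) Tr{(∑ₗ I_S(ψ, Wₗ))⁻¹ (Vᴴ V)}`. -/
noncomputable def crlb {M N q k : ℕ} (r σ : ℝ) (W : Fin k → Matrix (Fin M × Fin N) (Fin q) ℂ)
    (ψ : Param) : ℂ :=
  1 / ((M : ℂ) * (N : ℂ)) *
    Matrix.trace ((∑ l, fisher r σ (W l) ψ)⁻¹.map Complex.ofReal *
      ((jacobian M N ψ).conjTranspose * jacobian M N ψ))

end BeamTracking

namespace BeamTracking

open ProbabilityTheory Filter Topology
open scoped NNReal ENNReal

/-! The observations are Gaussian with known covariance, and only their mean μ depends on ψ. The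
score is therefore the linear functional (2/σ²) Re⟨∂μ, y - μ⟩ of the noise (`score_eq`). Such
functionals are centred Gaussian, so their covariances follow by polarization; each score
contributes a factor 2/σ² and the noise covariance contributes σ²/2, which gives the Fisher matrix
(`fisher_eq`).

For the bound, an arbitrary unbiased estimate offers nothing to justify differentiating under the
integral sign. Instead the statistical model is shown to be differentiable in L²: the quotients (L_t
- 1)/t of the likelihood ratio along a coordinate line converge in L² to the score
(`tendsto_integral_likelihoodRatio_quotient_sub_sq`), because every moment involved is explicit.
Pairing this limit with a square-integrable error ε_p of entry p gives E[S_i ε_p] = V_{p i}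
(`integral_jointScore_mul_error`).

With J the summed Fisher matrix and c = J⁻¹ V_p, where V_p is row p of V, expanding E|ε_p - ∑ c_i
S_i|² ≥ 0 bounds E|ε_p|² below by V_pᴴ J⁻¹ V_p (`re_sum_le_integral_error_sq`). Summing over p
produces the trace. If the mean square error is infinite, nothing has to be proved. -/

/-! ### Sums and densities on product spaces -/

/-- A sum of functions of independent coordinates that are centred Gaussian is Gaussian. -/
lemma map_sum_pi_gaussianReal {ι : Type*} [Fintype ι] {X : ι → Type*}
    [∀ i, MeasurableSpace (X i)] {μ : ∀ i, Measure (X i)} [∀ i, IsProbabilityMeasure (μ i)]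
    {f : ∀ i, X i → ℝ} (hf : ∀ i, Measurable (f i)) {v : ι → ℝ≥0}
    (h : ∀ i, (μ i).map (f i) = gaussianReal 0 (v i)) :
    (Measure.pi μ).map (fun x => ∑ i, f i (x i)) = gaussianReal 0 (∑ i, v i) := by
  have hm : ∀ i, Measurable (fun x : ∀ i, X i => f i (x i)) :=
    fun i => (hf i).comp (measurable_pi_apply i)
  have : IsFiniteMeasure ((Measure.pi μ).map (fun x => ∑ i, f i (x i))) :=
    Measure.isFiniteMeasure_map _ _
  refine Measure.ext_of_charFun ?_
  rw [(iIndepFun_pi (μ := μ) (X := f) fun i => (hf i).aemeasurable).charFun_map_fun_sum_eq_prod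
    fun i => (hm i).aemeasurable]
  ext t
  have h' : ∀ i, (Measure.pi μ).map (fun x : ∀ i, X i => f i (x i)) = gaussianReal 0 (v i) := by
    intro i
    rw [← h i, ← (measurePreserving_eval μ i).map_eq,
      Measure.map_map (hf i) (measurable_pi_apply i)]
    rfl
  simp only [Finset.prod_apply, h', charFun_gaussianReal, ← Complex.exp_sum]
  congr 1
  push_cast
  simp [Finset.sum_mul, Finset.sum_div]

/-- A product of measures with integrable densities has the product of the densities. -/
lemma pi_withDensity_ofReal {ι : Type*} [Fintype ι] {X : ι → Type*}
    [∀ i, MeasurableSpace (X i)] {μ : ∀ i, Measure (X i)} [∀ i, SigmaFinite (μ i)]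
    {f : ∀ i, X i → ℝ} (hf : ∀ i, Integrable (f i) (μ i)) (h0 : ∀ i x, 0 ≤ f i x) :
    Measure.pi (fun i => (μ i).withDensity fun x => ENNReal.ofReal (f i x)) =
      (Measure.pi μ).withDensity fun x => ENNReal.ofReal (∏ i, f i (x i)) := by
  have : ∀ i, IsFiniteMeasure ((μ i).withDensity fun x => ENNReal.ofReal (f i x)) :=
    fun i => isFiniteMeasure_withDensity_ofReal (hf i).2
  refine Measure.pi_eq fun s hs => ?_
  have hprod : Integrable (fun x : ∀ i, X i => ∏ i, f i (x i)) (Measure.pi μ) :=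
    Integrable.fintype_prod_dep hf
  rw [withDensity_apply _ (MeasurableSet.univ_pi hs)]
  -- Nonnegativity and integrability allow the passage to the Bochner integral, which factors over
  -- the box, and back.
  rw [← ofReal_integral_eq_lintegral_ofReal hprod.restrict
    (Filter.Eventually.of_forall fun x => Finset.prod_nonneg fun i _ => h0 i _)]
  rw [Measure.restrict_pi_pi, integral_fintype_prod_eq_prod, ENNReal.ofReal_prod_of_nonneg
    fun i _ => integral_nonneg fun x => h0 i x]
  refine Finset.prod_congr rfl fun i _ => ?_
  rw [withDensity_apply _ (hs i), ofReal_integral_eq_lintegral_ofReal (hf i).restrict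
    (Filter.Eventually.of_forall fun x => h0 i x)]

/-! ### The complex normal law -/

/-- The density of the circularly symmetric complex normal law `CN(m, σ²)`. -/
noncomputable def complexNormalPDF (σ : ℝ) (m y : ℂ) : ℝ :=
  1 / (Real.pi * σ ^ 2) * Real.exp (-‖y - m‖ ^ 2 / σ ^ 2)

lemma complexNormalPDF_nonneg (σ : ℝ) (m y : ℂ) : 0 ≤ complexNormalPDF σ m y := by
  unfold complexNormalPDF; positivity

lemma measurable_complexNormalPDF (σ : ℝ) (m : ℂ) : Measurable (complexNormalPDF σ m) := by
  unfold complexNormalPDF; fun_prop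

/-- The circularly symmetric complex normal law `CN(m, σ²)`. -/
noncomputable def complexNormal (σ : ℝ) (m : ℂ) : Measure ℂ :=
  volume.withDensity fun y => ENNReal.ofReal (complexNormalPDF σ m y)

/-- Circular symmetry splits the variance σ² evenly: the real and imaginary parts are independent
with variance σ²/2 each. -/
lemma complexNormalPDF_eq_mul {σ : ℝ} (hσ : 0 < σ) (m y : ℂ) :
    complexNormalPDF σ m y = gaussianPDFReal m.re (σ ^ 2 / 2).toNNReal y.re *
      gaussianPDFReal m.im (σ ^ 2 / 2).toNNReal y.im := by
  have h : (((σ ^ 2 / 2).toNNReal : ℝ≥0) : ℝ) = σ ^ 2 / 2 := Real.coe_toNNReal _ (by positivity)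
  simp only [gaussianPDFReal, h, complexNormalPDF]
  have h2 : √(2 * Real.pi * (σ ^ 2 / 2)) * √(2 * Real.pi * (σ ^ 2 / 2)) = Real.pi * σ ^ 2 := by
    rw [Real.mul_self_sqrt (by positivity)]; ring
  rw [mul_mul_mul_comm, ← mul_inv, h2, ← Real.exp_add, one_div, Complex.sq_norm,
    Complex.normSq_apply]
  congr 2
  simp only [Complex.sub_re, Complex.sub_im]
  field_simp
  ring

lemma complexNormal_eq_map {σ : ℝ} (hσ : 0 < σ) (m : ℂ) :
    complexNormal σ m = ((gaussianReal m.re (σ ^ 2 / 2).toNNReal).prod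
      (gaussianReal m.im (σ ^ 2 / 2).toNNReal)).map Complex.measurableEquivRealProd.symm := by
  have hv : (σ ^ 2 / 2).toNNReal ≠ 0 := by
    rw [Ne, Real.toNNReal_eq_zero, not_le]; positivity
  rw [gaussianReal_of_var_ne_zero _ hv, gaussianReal_of_var_ne_zero _ hv,
    prod_withDensity (by fun_prop) (by fun_prop)]
  ext s hs
  rw [complexNormal, withDensity_apply _ hs, MeasurableEquiv.map_apply,
    withDensity_apply _ (Complex.measurableEquivRealProd.symm.measurable hs),
    ← (Complex.volume_preserving_equiv_real_prod.symm).setLIntegral_comp_preimage_emb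
      Complex.measurableEquivRealProd.symm.measurableEmbedding]
  refine lintegral_congr fun a => ?_
  rw [complexNormalPDF_eq_mul hσ, ENNReal.ofReal_mul (gaussianPDFReal_nonneg _ _ _)]
  rfl

lemma isProbabilityMeasure_complexNormal {σ : ℝ} (hσ : 0 < σ) (m : ℂ) :
    IsProbabilityMeasure (complexNormal σ m) := by
  rw [complexNormal_eq_map hσ]
  exact Measure.isProbabilityMeasure_map (by fun_prop)

lemma integrable_complexNormalPDF {σ : ℝ} (hσ : 0 < σ) (m : ℂ) :
    Integrable (complexNormalPDF σ m) := by
  have := isProbabilityMeasure_complexNormal hσ m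
  refine (lintegral_ofReal_ne_top_iff_integrable
    (measurable_complexNormalPDF σ m).aestronglyMeasurable
    (Filter.Eventually.of_forall fun y => complexNormalPDF_nonneg σ m y)).1 ?_
  have h := measure_univ (μ := complexNormal σ m)
  rw [complexNormal, withDensity_apply _ MeasurableSet.univ, Measure.restrict_univ] at h
  simp [h]

/-- A real linear functional of centred complex normal noise is Gaussian. -/
lemma map_re_conj_mul_complexNormal {σ : ℝ} (hσ : 0 < σ) (m c : ℂ) :
    (complexNormal σ m).map (fun y => (starRingEnd ℂ c * (y - m)).re) =
      gaussianReal 0 (σ ^ 2 / 2 * ‖c‖ ^ 2).toNNReal := by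
  set v := (σ ^ 2 / 2).toNNReal
  -- Re(c̄(y - m)) is the sum of c.re (y.re - m.re) and c.im (y.im - m.im), which are independent
  -- real Gaussians.
  have hind := indepFun_prod (μ := gaussianReal m.re v) (ν := gaussianReal m.im v)
    (X := fun x => c.re * (x - m.re)) (Y := fun x => c.im * (x - m.im))
    (by fun_prop) (by fun_prop)
  have hlaw : ∀ a b : ℝ, (gaussianReal b v).map (fun x => a * (x - b)) =
      gaussianReal 0 (.mk (a ^ 2) (sq_nonneg _) * v) := by
    intro a b
    rw [← Function.comp_def (fun x => a * x) (fun x => x - b),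
      ← Measure.map_map (by fun_prop) (by fun_prop), gaussianReal_map_sub_const,
      gaussianReal_map_const_mul]
    simp
  have h1 : ((gaussianReal m.re v).prod (gaussianReal m.im v)).map
      (fun p => c.re * (p.1 - m.re)) = gaussianReal 0 (.mk (c.re ^ 2) (sq_nonneg _) * v) := by
    rw [← hlaw c.re m.re, ← Function.comp_def (fun x => c.re * (x - m.re)) Prod.fst,
      ← Measure.map_map (by fun_prop) (by fun_prop), Measure.map_fst_prod]
    simp
  have h2 : ((gaussianReal m.re v).prod (gaussianReal m.im v)).map
      (fun p => c.im * (p.2 - m.im)) = gaussianReal 0 (.mk (c.im ^ 2) (sq_nonneg _) * v) := by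
    rw [← hlaw c.im m.im, ← Function.comp_def (fun x => c.im * (x - m.im)) Prod.snd,
      ← Measure.map_map (by fun_prop) (by fun_prop), Measure.map_snd_prod]
    simp
  have h := gaussianReal_add_gaussianReal_of_indepFun hind h1 h2
  rw [complexNormal_eq_map hσ, Measure.map_map (by fun_prop) (by fun_prop)]
  convert! h using 2
  · ext p
    simp [Complex.measurableEquivRealProd]
  · simp
  · ext
    rw [Real.coe_toNNReal _ (by positivity), Complex.sq_norm, Complex.normSq_apply]
    simp only [NNReal.coe_add, NNReal.coe_mul, NNReal.coe_mk, v]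
    rw [Real.coe_toNNReal _ (by positivity)]
    ring

/-! ### Linear functionals of complex normal arrays -/

/-- The real inner product of two complex vectors. -/
noncomputable def reInner {ι : Type*} [Fintype ι] (c d : ι → ℂ) : ℝ :=
  ∑ i, (starRingEnd ℂ (c i) * d i).re

/-- The real inner product of two complex arrays. -/
noncomputable def reInner₂ {κ ι : Type*} [Fintype κ] [Fintype ι] (c d : κ → ι → ℂ) : ℝ :=
  ∑ l, reInner (c l) (d l)

/-- The law of a vector of independent complex normal entries. -/
noncomputable def vecNormal {ι : Type*} [Fintype ι] (σ : ℝ) (m : ι → ℂ) : Measure (ι → ℂ) :=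
  Measure.pi fun i => complexNormal σ (m i)

/-- The law of an array of independent complex normal entries. -/
noncomputable def arrayNormal {κ ι : Type*} [Fintype κ] [Fintype ι] (σ : ℝ) (m : κ → ι → ℂ) :
    Measure (κ → ι → ℂ) :=
  Measure.pi fun l => vecNormal σ (m l)

section

variable {κ ι : Type*} [Fintype κ] [Fintype ι]

lemma reInner_self (c : ι → ℂ) : reInner c c = ∑ i, ‖c i‖ ^ 2 := by
  refine Finset.sum_congr rfl fun i _ => ?_
  rw [Complex.sq_norm, Complex.normSq_apply]
  simp

lemma reInner_self_nonneg (c : ι → ℂ) : 0 ≤ reInner c c := by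
  rw [reInner_self]; positivity

lemma reInner_add_left (c d e : ι → ℂ) : reInner (c + d) e = reInner c e + reInner d e := by
  simp only [reInner, ← Finset.sum_add_distrib]
  simp [add_mul]

lemma reInner_add_right (c d e : ι → ℂ) : reInner c (d + e) = reInner c d + reInner c e := by
  simp only [reInner, ← Finset.sum_add_distrib]
  simp [mul_add]

lemma reInner_comm (c d : ι → ℂ) : reInner c d = reInner d c := by
  refine Finset.sum_congr rfl fun i _ => ?_
  simp [mul_comm]

lemma reInner₂_self_nonneg (c : κ → ι → ℂ) : 0 ≤ reInner₂ c c :=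
  Finset.sum_nonneg fun _ _ => reInner_self_nonneg _

lemma reInner₂_add_left (c d e : κ → ι → ℂ) :
    reInner₂ (c + d) e = reInner₂ c e + reInner₂ d e := by
  simp [reInner₂, reInner_add_left, Finset.sum_add_distrib]

lemma reInner₂_add_right (c d e : κ → ι → ℂ) :
    reInner₂ c (d + e) = reInner₂ c d + reInner₂ c e := by
  simp [reInner₂, reInner_add_right, Finset.sum_add_distrib]

lemma reInner₂_comm (c d : κ → ι → ℂ) : reInner₂ c d = reInner₂ d c :=
  Finset.sum_congr rfl fun _ _ => reInner_comm _ _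

lemma continuous_reInner₂ :
    Continuous fun p : (κ → ι → ℂ) × (κ → ι → ℂ) => reInner₂ p.1 p.2 := by
  unfold reInner₂ reInner; fun_prop

lemma measurable_reInner (c m : ι → ℂ) : Measurable fun y => reInner c (y - m) := by
  unfold reInner; fun_prop

lemma measurable_reInner₂ (c m : κ → ι → ℂ) : Measurable fun y => reInner₂ c (y - m) := by
  unfold reInner₂ reInner; fun_prop

lemma isProbabilityMeasure_vecNormal {σ : ℝ} (hσ : 0 < σ) (m : ι → ℂ) :
    IsProbabilityMeasure (vecNormal σ m) := by
  have := fun i => isProbabilityMeasure_complexNormal hσ (m i)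
  unfold vecNormal; infer_instance

lemma isProbabilityMeasure_arrayNormal {σ : ℝ} (hσ : 0 < σ) (m : κ → ι → ℂ) :
    IsProbabilityMeasure (arrayNormal σ m) := by
  have := fun l => isProbabilityMeasure_vecNormal hσ (m l)
  unfold arrayNormal; infer_instance

lemma map_reInner_vecNormal {σ : ℝ} (hσ : 0 < σ) (m c : ι → ℂ) :
    (vecNormal σ m).map (fun y => reInner c (y - m)) =
      gaussianReal 0 (σ ^ 2 / 2 * reInner c c).toNNReal := by
  have := fun i => isProbabilityMeasure_complexNormal hσ (m i)
  refine (map_sum_pi_gaussianReal (f := fun i y => (starRingEnd ℂ (c i) * (y - m i)).re)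
    (fun i => by fun_prop) fun i => map_re_conj_mul_complexNormal hσ (m i) (c i)).trans ?_
  rw [reInner_self, Finset.mul_sum, Real.toNNReal_sum_of_nonneg fun i _ => by positivity]

lemma map_reInner₂_arrayNormal {σ : ℝ} (hσ : 0 < σ) (m c : κ → ι → ℂ) :
    (arrayNormal σ m).map (fun y => reInner₂ c (y - m)) =
      gaussianReal 0 (σ ^ 2 / 2 * reInner₂ c c).toNNReal := by
  have := fun l => isProbabilityMeasure_vecNormal hσ (m l)
  refine (map_sum_pi_gaussianReal (f := fun l y => reInner (c l) (y - m l))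
    (fun l => measurable_reInner _ _) fun l => map_reInner_vecNormal hσ (m l) (c l)).trans ?_
  rw [reInner₂, Finset.mul_sum, Real.toNNReal_sum_of_nonneg fun i _ =>
    mul_nonneg (by positivity) (reInner_self_nonneg _)]

end

/-! ### Moments of real Gaussian variables -/

section Gaussian

variable {Ω : Type*} [MeasurableSpace Ω] {P : Measure Ω} {X Y : Ω → ℝ} {v w u : ℝ≥0}

lemma memLp_two_of_map_gaussianReal (hX : Measurable X) (h : P.map X = gaussianReal 0 v) :
    MemLp X 2 P := by
  have := memLp_id_gaussianReal' (μ := 0) (v := v) 2 (by simp)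
  rw [← h] at this
  exact (memLp_map_measure_iff aestronglyMeasurable_id hX.aemeasurable).1 this

lemma integral_eq_zero_of_map_gaussianReal (hX : Measurable X) (h : P.map X = gaussianReal 0 v) :
    ∫ x, X x ∂P = 0 := by
  rw [← integral_map (f := fun x => x) hX.aemeasurable aestronglyMeasurable_id, h,
    integral_id_gaussianReal]

lemma integral_sq_of_map_gaussianReal (hX : Measurable X) (h : P.map X = gaussianReal 0 v) :
    ∫ x, X x ^ 2 ∂P = v := by
  rw [← integral_map (f := fun x => x ^ 2) hX.aemeasurable (by fun_prop), h,
    ← variance_id_gaussianReal (μ := 0) (v := v), variance_eq_integral aemeasurable_id]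
  simp

/-- The covariance of jointly Gaussian variables by polarization. -/
lemma integral_mul_of_map_gaussianReal (hX : Measurable X) (hY : Measurable Y)
    (h : P.map X = gaussianReal 0 v) (h' : P.map Y = gaussianReal 0 w)
    (hXY : P.map (fun x => X x + Y x) = gaussianReal 0 u) :
    ∫ x, X x * Y x ∂P = (u - v - w) / 2 := by
  have h1 := memLp_two_of_map_gaussianReal hX h
  have h2 := memLp_two_of_map_gaussianReal hY h'
  have h3 : Integrable (fun x => (X x + Y x) ^ 2) P := (h1.add h2).integrable_sq
  have h4 : Integrable (fun x => (X x + Y x) ^ 2 - X x ^ 2) P := h3.sub h1.integrable_sq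
  have e : ∀ x, X x * Y x = ((X x + Y x) ^ 2 - X x ^ 2 - Y x ^ 2) / 2 := fun x => by ring
  simp only [e]
  rw [integral_div, integral_sub h4 h2.integrable_sq, integral_sub h3 h1.integrable_sq,
    ← integral_sq_of_map_gaussianReal (hX.add hY) hXY, ← integral_sq_of_map_gaussianReal hX h,
    ← integral_sq_of_map_gaussianReal hY h']
  rfl

lemma integral_exp_mul_of_map_gaussianReal (h : P.map X = gaussianReal 0 v) (t : ℝ) :
    ∫ x, Real.exp (t * X x) ∂P = Real.exp (v * t ^ 2 / 2) := by
  have := mgf_gaussianReal h t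
  simpa [mgf] using this

lemma integrable_exp_mul_of_map_gaussianReal (hX : Measurable X) (h : P.map X = gaussianReal 0 v)
    (t : ℝ) : Integrable (fun x => Real.exp (t * X x)) P := by
  have := integrable_exp_mul_gaussianReal (μ := 0) (v := v) t
  rw [← h] at this
  exact this.comp_measurable hX

end Gaussian

/-! ### Noise covariances and the likelihood ratio of a mean shift -/

section

variable {κ ι : Type*} [Fintype κ] [Fintype ι]

lemma memLp_reInner_vecNormal {σ : ℝ} (hσ : 0 < σ) (m c : ι → ℂ) :
    MemLp (fun y => reInner c (y - m)) 2 (vecNormal σ m) :=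
  memLp_two_of_map_gaussianReal (measurable_reInner c m) (map_reInner_vecNormal hσ m c)

/-- The two functionals add up to the functional of `c + d`, which is again Gaussian, so polarizing
the variance leaves the cross term. -/
lemma integral_reInner_mul_vecNormal {σ : ℝ} (hσ : 0 < σ) (m c d : ι → ℂ) :
    ∫ y, reInner c (y - m) * reInner d (y - m) ∂vecNormal σ m = σ ^ 2 / 2 * reInner c d := by
  have h := map_reInner_vecNormal hσ m (c + d)
  simp only [reInner_add_left _ _ (_ - _)] at h
  rw [integral_mul_of_map_gaussianReal (measurable_reInner c m) (measurable_reInner d m)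
    (map_reInner_vecNormal hσ m c) (map_reInner_vecNormal hσ m d) h]
  have h0 := fun c : ι → ℂ => mul_nonneg (a := σ ^ 2 / 2) (by positivity) (reInner_self_nonneg c)
  rw [Real.coe_toNNReal _ (h0 _), Real.coe_toNNReal _ (h0 _), Real.coe_toNNReal _ (h0 _)]
  simp only [reInner_add_left, reInner_add_right, reInner_comm d c]
  ring

lemma memLp_reInner₂_arrayNormal {σ : ℝ} (hσ : 0 < σ) (m c : κ → ι → ℂ) :
    MemLp (fun y => reInner₂ c (y - m)) 2 (arrayNormal σ m) :=
  memLp_two_of_map_gaussianReal (measurable_reInner₂ c m) (map_reInner₂_arrayNormal hσ m c)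

lemma integral_reInner₂_mul_arrayNormal {σ : ℝ} (hσ : 0 < σ) (m c d : κ → ι → ℂ) :
    ∫ y, reInner₂ c (y - m) * reInner₂ d (y - m) ∂arrayNormal σ m =
      σ ^ 2 / 2 * reInner₂ c d := by
  have h := map_reInner₂_arrayNormal hσ m (c + d)
  simp only [reInner₂_add_left _ _ (_ - _)] at h
  rw [integral_mul_of_map_gaussianReal (measurable_reInner₂ c m) (measurable_reInner₂ d m)
    (map_reInner₂_arrayNormal hσ m c) (map_reInner₂_arrayNormal hσ m d) h]
  have h0 := fun c : κ → ι → ℂ =>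
    mul_nonneg (a := σ ^ 2 / 2) (by positivity) (reInner₂_self_nonneg c)
  rw [Real.coe_toNNReal _ (h0 _), Real.coe_toNNReal _ (h0 _), Real.coe_toNNReal _ (h0 _)]
  simp only [reInner₂_add_left, reInner₂_add_right, reInner₂_comm d c]
  ring

/-- The likelihood ratio of the complex normal laws with means `m + Δ` and `m`. -/
noncomputable def likelihoodRatio (σ : ℝ) (m Δ y : κ → ι → ℂ) : ℝ :=
  Real.exp ((2 * reInner₂ Δ (y - m) - reInner₂ Δ Δ) / σ ^ 2)

lemma likelihoodRatio_nonneg (σ : ℝ) (m Δ y : κ → ι → ℂ) : 0 ≤ likelihoodRatio σ m Δ y :=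
  Real.exp_nonneg _

/-- Expand |y - m - Δ|² = |y - m|² - 2 Re(Δ̄(y - m)) + |Δ|². -/
lemma complexNormalPDF_add (σ : ℝ) (m Δ y : ℂ) :
    complexNormalPDF σ (m + Δ) y = complexNormalPDF σ m y *
      Real.exp ((2 * (starRingEnd ℂ Δ * (y - m)).re - (starRingEnd ℂ Δ * Δ).re) / σ ^ 2) := by
  rw [complexNormalPDF, complexNormalPDF, mul_assoc, ← Real.exp_add, ← add_div]
  congr 3
  simp only [Complex.sq_norm, Complex.normSq_apply, Complex.sub_re, Complex.sub_im,
    Complex.add_re, Complex.add_im, Complex.mul_re, Complex.conj_re, Complex.conj_im]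
  ring

lemma complexNormal_add (σ : ℝ) (m Δ : ℂ) :
    complexNormal σ (m + Δ) = (complexNormal σ m).withDensity fun y => ENNReal.ofReal
      (Real.exp ((2 * (starRingEnd ℂ Δ * (y - m)).re - (starRingEnd ℂ Δ * Δ).re) / σ ^ 2)) := by
  rw [complexNormal, complexNormal, ← withDensity_mul _
    (measurable_complexNormalPDF σ m).ennreal_ofReal (by fun_prop)]
  congr 1
  ext y
  rw [Pi.mul_apply, complexNormalPDF_add, ENNReal.ofReal_mul (complexNormalPDF_nonneg _ _ _)]

lemma integrable_exp_of_map_gaussianReal {Ω : Type*} [MeasurableSpace Ω] {P : Measure Ω}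
    {X : Ω → ℝ} {v : ℝ≥0} (hX : Measurable X) (h : P.map X = gaussianReal 0 v) (a b σ : ℝ) :
    Integrable (fun x => Real.exp ((a * X x - b) / σ ^ 2)) P := by
  have := (integrable_exp_mul_of_map_gaussianReal hX h (a / σ ^ 2)).const_mul
    (Real.exp (-b / σ ^ 2))
  refine this.congr (Filter.Eventually.of_forall fun x => ?_)
  simp only [← Real.exp_add]
  congr 1
  ring

lemma vecNormal_add {σ : ℝ} (hσ : 0 < σ) (m Δ : ι → ℂ) :
    vecNormal σ (m + Δ) = (vecNormal σ m).withDensity fun y => ENNReal.ofReal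
      (Real.exp ((2 * reInner Δ (y - m) - reInner Δ Δ) / σ ^ 2)) := by
  have := fun i => isProbabilityMeasure_complexNormal hσ (m i)
  simp only [vecNormal, Pi.add_apply, complexNormal_add]
  rw [pi_withDensity_ofReal (fun i => integrable_exp_of_map_gaussianReal (by fun_prop)
    (map_re_conj_mul_complexNormal hσ _ _) _ _ _) fun i x => Real.exp_nonneg _]
  simp only [← Real.exp_sum, ← Finset.sum_div, Finset.sum_sub_distrib, ← Finset.mul_sum, reInner,
    Pi.sub_apply]

lemma arrayNormal_add {σ : ℝ} (hσ : 0 < σ) (m Δ : κ → ι → ℂ) :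
    arrayNormal σ (m + Δ) = (arrayNormal σ m).withDensity fun y =>
      ENNReal.ofReal (likelihoodRatio σ m Δ y) := by
  have := fun l => isProbabilityMeasure_vecNormal hσ (m l)
  simp only [arrayNormal, Pi.add_apply, vecNormal_add hσ]
  rw [pi_withDensity_ofReal (fun i => integrable_exp_of_map_gaussianReal (measurable_reInner _ _)
    (map_reInner_vecNormal hσ _ _) _ _ _) fun i x => Real.exp_nonneg _]
  simp only [← Real.exp_sum, ← Finset.sum_div, Finset.sum_sub_distrib, ← Finset.mul_sum, reInner₂,
    Pi.sub_apply, likelihoodRatio]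

lemma measurable_likelihoodRatio (σ : ℝ) (m Δ : κ → ι → ℂ) :
    Measurable (likelihoodRatio σ m Δ) := by
  have := measurable_reInner₂ Δ m
  unfold likelihoodRatio
  fun_prop

lemma likelihoodRatio_sq (σ : ℝ) (m Δ y : κ → ι → ℂ) :
    likelihoodRatio σ m Δ y ^ 2 =
      Real.exp ((4 * reInner₂ Δ (y - m) - 2 * reInner₂ Δ Δ) / σ ^ 2) := by
  rw [likelihoodRatio, ← Real.exp_nat_mul]
  congr 1
  push_cast
  ring

lemma memLp_likelihoodRatio {σ : ℝ} (hσ : 0 < σ) (m Δ : κ → ι → ℂ) :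
    MemLp (likelihoodRatio σ m Δ) 2 (arrayNormal σ m) := by
  rw [memLp_two_iff_integrable_sq (measurable_likelihoodRatio σ m Δ).aestronglyMeasurable]
  simp only [likelihoodRatio_sq]
  exact integrable_exp_of_map_gaussianReal (measurable_reInner₂ _ _)
    (map_reInner₂_arrayNormal hσ m Δ) _ _ _

/-- The Gaussian moment generating function at 4/σ², with variance (σ²/2)|Δ|², gives exp(4|Δ|²/σ²);
the constant factor is exp(-2|Δ|²/σ²). -/
lemma integral_likelihoodRatio_sq {σ : ℝ} (hσ : 0 < σ) (m Δ : κ → ι → ℂ) :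
    ∫ y, likelihoodRatio σ m Δ y ^ 2 ∂arrayNormal σ m =
      Real.exp (2 * reInner₂ Δ Δ / σ ^ 2) := by
  have h : ∀ y, likelihoodRatio σ m Δ y ^ 2 =
      Real.exp (-(2 * reInner₂ Δ Δ) / σ ^ 2) * Real.exp (4 / σ ^ 2 * reInner₂ Δ (y - m)) := by
    intro y
    rw [likelihoodRatio_sq, ← Real.exp_add]
    congr 1
    ring
  simp only [h]
  rw [integral_const_mul, integral_exp_mul_of_map_gaussianReal
    (map_reInner₂_arrayNormal hσ m Δ), ← Real.exp_add, Real.coe_toNNReal _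
    (mul_nonneg (by positivity) (reInner₂_self_nonneg _))]
  congr 1
  field_simp
  ring

/-- Expectations under the shifted law are weighted by the likelihood ratio. -/
lemma integral_arrayNormal_add {E : Type*} [NormedAddCommGroup E] [NormedSpace ℝ E] {σ : ℝ}
    (hσ : 0 < σ) (m Δ : κ → ι → ℂ) (f : (κ → ι → ℂ) → E) :
    ∫ y, f y ∂arrayNormal σ (m + Δ) = ∫ y, likelihoodRatio σ m Δ y • f y ∂arrayNormal σ m := by
  rw [arrayNormal_add hσ, integral_withDensity_eq_integral_toReal_smul
    (measurable_likelihoodRatio σ m Δ).ennreal_ofReal (by simp)]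
  refine integral_congr_ae (Filter.Eventually.of_forall fun y => ?_)
  simp only
  rw [ENNReal.toReal_ofReal (likelihoodRatio_nonneg σ m Δ y)]

lemma integral_likelihoodRatio {σ : ℝ} (hσ : 0 < σ) (m Δ : κ → ι → ℂ) :
    ∫ y, likelihoodRatio σ m Δ y ∂arrayNormal σ m = 1 := by
  have := isProbabilityMeasure_arrayNormal hσ (m + Δ)
  have h := integral_arrayNormal_add hσ m Δ (fun _ => (1 : ℝ))
  simpa using h.symm

/-- Weighting by the ratio moves the mean to `m + Δ`, and under that law `y - m` has mean `Δ`. -/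
lemma integral_likelihoodRatio_mul {σ : ℝ} (hσ : 0 < σ) (m Δ c : κ → ι → ℂ) :
    ∫ y, likelihoodRatio σ m Δ y * reInner₂ c (y - m) ∂arrayNormal σ m = reInner₂ c Δ := by
  have := isProbabilityMeasure_arrayNormal hσ (m + Δ)
  have h0 := integral_arrayNormal_add hσ m Δ fun y => reInner₂ c (y - m)
  simp only [smul_eq_mul] at h0
  rw [← h0]
  have h : ∀ y, reInner₂ c (y - m) = reInner₂ c (y - (m + Δ)) + reInner₂ c Δ := by
    intro y
    rw [← reInner₂_add_right]
    congr 1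
    abel
  simp only [h]
  rw [integral_add ((memLp_reInner₂_arrayNormal hσ _ c).integrable (by norm_num))
    (integrable_const _), integral_eq_zero_of_map_gaussianReal (measurable_reInner₂ _ _)
    (map_reInner₂_arrayNormal hσ (m + Δ) c)]
  simp

end

/-! ### The Jacobian matrix of the channel -/

lemma differentiable_gain : Differentiable ℝ gain := by
  unfold gain
  have h : ∀ i : Fin 4, Differentiable ℝ fun φ : Param => ((φ i : ℝ) : ℂ) := fun i =>
    Complex.ofRealCLM.differentiable.comp (differentiable_apply i)
  exact (h 0).add ((h 1).mul_const _)

lemma differentiable_steering1 (n : ℕ) (m : Fin n) :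
    Differentiable ℝ fun t : ℝ => steering1 n t m := by
  unfold steering1
  exact (Complex.ofRealCLM.differentiable.const_mul _).cexp

lemma differentiable_channel (M N : ℕ) (p : Fin M × Fin N) :
    Differentiable ℝ fun φ : Param => channel M N φ p := by
  unfold channel steering
  exact differentiable_gain.mul (((differentiable_steering1 M p.1).comp
    (differentiable_apply 2)).mul ((differentiable_steering1 N p.2).comp (differentiable_apply 3)))

/-- Restriction to coordinate lines reduces all later derivatives in ψ to one-variable calculus. -/
lemma hasDerivAt_channel_line (M N : ℕ) (ψ : Param) (i : Fin 4) (p : Fin M × Fin N) :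
    HasDerivAt (fun t : ℝ => channel M N (ψ + t • Pi.single i 1) p) (jacobian M N ψ p i) 0 :=
  ((differentiable_channel M N p) ψ).hasFDerivAt.hasLineDerivAt (Pi.single i 1)

lemma jacobian_eq (M N : ℕ) (ψ : Param) :
    jacobian M N ψ = Matrix.of fun p =>
      ![steering M N (ψ 2) (ψ 3) p,
        Complex.I * steering M N (ψ 2) (ψ 3) p,
        gain ψ * deriv (fun t : ℝ => steering M N t (ψ 3) p) (ψ 2),
        gain ψ * deriv (fun t : ℝ => steering M N (ψ 2) t p) (ψ 3)] := by
  ext p i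
  rw [← (hasDerivAt_channel_line M N ψ i p).deriv]
  have hof : HasDerivAt (fun t : ℝ => (t : ℂ)) 1 0 := Complex.ofRealCLM.hasDerivAt
  have d1 : DifferentiableAt ℝ (fun t : ℝ => steering M N t (ψ 3) p) (ψ 2) :=
    (differentiable_steering1 M p.1).mul_const _ _
  have d2 : DifferentiableAt ℝ (fun t : ℝ => steering M N (ψ 2) t p) (ψ 3) :=
    (differentiable_steering1 N p.2).const_mul _ _
  fin_cases i
  -- The first two coordinates move the gain to β + t and β + tj and fix a(x), so the channel entry
  -- is affine in t.
  · have h := ((hof.const_add (gain ψ)).mul_const (steering M N (ψ 2) (ψ 3) p)).deriv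
    rw [one_mul] at h
    refine Eq.trans ?_ h
    congr 1
    ext t
    simp only [channel, gain, Pi.add_apply, Pi.smul_apply, Pi.single_apply, smul_eq_mul]
    simp
    left
    ring
  · have h := (((hof.mul_const Complex.I).const_add (gain ψ)).mul_const
      (steering M N (ψ 2) (ψ 3) p)).deriv
    rw [one_mul] at h
    refine Eq.trans ?_ h
    congr 1
    ext t
    simp only [channel, gain, Pi.add_apply, Pi.smul_apply, Pi.single_apply, smul_eq_mul]
    simp
    left
    ring
  · have h : HasDerivAt (fun t : ℝ => steering M N (ψ 2 + t) (ψ 3) p)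
        (deriv (fun t : ℝ => steering M N t (ψ 3) p) (ψ 2)) 0 :=
      HasDerivAt.comp_const_add (ψ 2) 0 (by rw [add_zero]; exact d1.hasDerivAt)
    refine Eq.trans ?_ (h.const_mul (gain ψ)).deriv
    congr 1
    ext t
    simp [channel, gain]
  · have h : HasDerivAt (fun t : ℝ => steering M N (ψ 2) (ψ 3 + t) p)
        (deriv (fun t : ℝ => steering M N (ψ 2) t p) (ψ 3)) 0 :=
      HasDerivAt.comp_const_add (ψ 3) 0 (by rw [add_zero]; exact d2.hasDerivAt)
    refine Eq.trans ?_ (h.const_mul (gain ψ)).deriv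
    congr 1
    ext t
    simp [channel, gain]

/-! ### Score and Fisher information of one observation -/

variable {M N q k : ℕ}

/-- The partial derivative of the mean of an observation vector. -/
noncomputable def obsMeanDeriv (r : ℝ) (W : Matrix (Fin M × Fin N) (Fin q) ℂ) (ψ : Param)
    (i : Fin 4) : Fin q → ℂ :=
  (r : ℂ) • W.conjTranspose.mulVec fun p => jacobian M N ψ p i

lemma hasDerivAt_obsMean_line (r : ℝ) (W : Matrix (Fin M × Fin N) (Fin q) ℂ) (ψ : Param)
    (i : Fin 4) :
    HasDerivAt (fun t : ℝ => obsMean r W (ψ + t • Pi.single i 1)) (obsMeanDeriv r W ψ i) 0 := by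
  refine hasDerivAt_pi.2 fun a => ?_
  simp only [obsMean, obsMeanDeriv, Pi.smul_apply, Matrix.mulVec, dotProduct, smul_eq_mul]
  exact (HasDerivAt.fun_sum fun p _ =>
    (hasDerivAt_channel_line M N ψ i p).const_mul _).const_mul _

lemma differentiable_obsMean (r : ℝ) (W : Matrix (Fin M × Fin N) (Fin q) ℂ) :
    Differentiable ℝ fun φ => obsMean r W φ := by
  refine differentiable_pi.2 fun a => ?_
  simp only [obsMean, Pi.smul_apply, Matrix.mulVec, dotProduct, smul_eq_mul]
  exact (Differentiable.fun_sum fun p _ =>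
    (differentiable_channel M N p).const_mul _).const_mul _

lemma obsDensity_eq_prod {σ : ℝ} (r : ℝ)
    (W : Matrix (Fin M × Fin N) (Fin q) ℂ) (ψ : Param) (y : Fin q → ℂ) :
    obsDensity r σ W ψ y = ∏ i, complexNormalPDF σ (obsMean r W ψ i) (y i) := by
  simp only [complexNormalPDF, Finset.prod_mul_distrib, ← Real.exp_sum, obsDensity]
  congr 1
  · simp [mul_pow, ← pow_mul]
  · rw [← Finset.sum_div, Finset.sum_neg_distrib]

lemma obsLaw_eq_vecNormal {σ : ℝ} (hσ : 0 < σ) (r : ℝ)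
    (W : Matrix (Fin M × Fin N) (Fin q) ℂ) (ψ : Param) :
    obsLaw r σ W ψ = vecNormal σ (obsMean r W ψ) := by
  simp only [obsLaw, vecNormal, complexNormal, obsDensity_eq_prod]
  rw [pi_withDensity_ofReal (fun i => integrable_complexNormalPDF hσ _)
    fun i x => complexNormalPDF_nonneg _ _ _]
  rfl

lemma jointLaw_eq_arrayNormal {σ : ℝ} (hσ : 0 < σ) (r : ℝ)
    (W : Fin k → Matrix (Fin M × Fin N) (Fin q) ℂ) (ψ : Param) :
    jointLaw r σ W ψ = arrayNormal σ fun l => obsMean r (W l) ψ := by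
  simp only [jointLaw, arrayNormal, obsLaw_eq_vecNormal hσ]

/-- The score is a linear functional of the noise. -/
lemma score_eq {σ : ℝ} (hσ : 0 < σ) (r : ℝ) (W : Matrix (Fin M × Fin N) (Fin q) ℂ) (ψ : Param)
    (y : Fin q → ℂ) (i : Fin 4) :
    score r σ W ψ y i = 2 / σ ^ 2 * reInner (obsMeanDeriv r W ψ i) (y - obsMean r W ψ) := by
  have hlog : ∀ φ, Real.log (obsDensity r σ W φ y) =
      Real.log (1 / (Real.pi ^ q * σ ^ (2 * q))) +
        -(∑ a, ‖y a - obsMean r W φ a‖ ^ 2) / σ ^ 2 := by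
    intro φ
    rw [obsDensity, Real.log_mul (by positivity) (Real.exp_ne_zero _), Real.log_exp]
  have hdm := fun a => differentiable_pi.1 (differentiable_obsMean r W) a
  -- `fderiv` is zero by default where differentiability fails, so differentiability comes before
  -- the comparison of line derivatives.
  have hd : Differentiable ℝ fun φ => Real.log (obsDensity r σ W φ y) := by
    simp only [hlog, div_eq_mul_inv]
    exact ((Differentiable.fun_sum fun a _ =>
      ((hdm a).const_sub (y a)).norm_sq ℝ).neg.mul_const _).const_add _
  have h1 := (hd ψ).hasFDerivAt.hasLineDerivAt (Pi.single i 1)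
  have h2 : HasDerivAt (fun t : ℝ => Real.log (obsDensity r σ W (ψ + t • Pi.single i 1) y))
      (2 / σ ^ 2 * reInner (obsMeanDeriv r W ψ i) (y - obsMean r W ψ)) 0 := by
    simp only [hlog]
    have h3 := ((HasDerivAt.fun_sum (u := Finset.univ) fun a _ =>
      ((hasDerivAt_pi.1 (hasDerivAt_obsMean_line r W ψ i) a).const_sub (y a)).norm_sq).neg.div_const
        (σ ^ 2)).const_add (Real.log (1 / (Real.pi ^ q * σ ^ (2 * q))))
    convert! h3 using 1
    simp only [zero_smul, add_zero, Complex.inner, reInner, Pi.sub_apply, ← Finset.mul_sum]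
    rw [div_mul_eq_mul_div, ← mul_neg, ← Finset.sum_neg_distrib]
    congr 2
    refine Finset.sum_congr rfl fun a _ => ?_
    simp
    ring
  exact HasDerivAt.unique h1 h2

/-- VᴴWWᴴV is the Gram matrix of the columns of WᴴV, and these columns scaled by `r` are the
derivatives of the mean. -/
lemma reInner_obsMeanDeriv (r : ℝ) (W : Matrix (Fin M × Fin N) (Fin q) ℂ) (ψ : Param)
    (i j : Fin 4) :
    reInner (obsMeanDeriv r W ψ i) (obsMeanDeriv r W ψ j) =
      r ^ 2 * (((jacobian M N ψ).conjTranspose * W * W.conjTranspose * jacobian M N ψ) i j).re := by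
  have h : (jacobian M N ψ).conjTranspose * W * W.conjTranspose * jacobian M N ψ =
      (W.conjTranspose * jacobian M N ψ).conjTranspose * (W.conjTranspose * jacobian M N ψ) := by
    simp only [Matrix.conjTranspose_mul, Matrix.conjTranspose_conjTranspose, Matrix.mul_assoc]
  have hc : ∀ i a, obsMeanDeriv r W ψ i a = r * (W.conjTranspose * jacobian M N ψ) a i :=
    fun i a => rfl
  rw [h, Matrix.mul_apply, Complex.re_sum, Finset.mul_sum]
  refine Finset.sum_congr rfl fun a _ => ?_
  rw [hc, hc, Matrix.conjTranspose_apply]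
  simp
  ring

lemma fisher_apply {σ : ℝ} (hσ : 0 < σ) (r : ℝ) (W : Matrix (Fin M × Fin N) (Fin q) ℂ)
    (ψ : Param) (i j : Fin 4) :
    fisher r σ W ψ i j =
      2 / σ ^ 2 * reInner (obsMeanDeriv r W ψ i) (obsMeanDeriv r W ψ j) := by
  have h : ∀ y, score r σ W ψ y i * score r σ W ψ y j = (2 / σ ^ 2) ^ 2 *
      (reInner (obsMeanDeriv r W ψ i) (y - obsMean r W ψ) *
        reInner (obsMeanDeriv r W ψ j) (y - obsMean r W ψ)) := by
    intro y
    rw [score_eq hσ, score_eq hσ]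
    ring
  simp only [fisher, Matrix.of_apply, h]
  rw [obsLaw_eq_vecNormal hσ, integral_const_mul, integral_reInner_mul_vecNormal hσ]
  field_simp

lemma integrable_score_mul {σ : ℝ} (hσ : 0 < σ) (r : ℝ) (W : Matrix (Fin M × Fin N) (Fin q) ℂ)
    (ψ : Param) (i j : Fin 4) :
    Integrable (fun y => score r σ W ψ y i * score r σ W ψ y j) (obsLaw r σ W ψ) := by
  simp only [score_eq hσ]
  rw [obsLaw_eq_vecNormal hσ]
  exact ((memLp_reInner_vecNormal hσ _ _).const_mul _).integrable_mul
    ((memLp_reInner_vecNormal hσ _ _).const_mul _)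

lemma fisher_eq {σ : ℝ} (hσ : 0 < σ) (r : ℝ) (W : Matrix (Fin M × Fin N) (Fin q) ℂ)
    (ψ : Param) :
    fisher r σ W ψ = (2 * r ^ 2 / σ ^ 2) •
      ((jacobian M N ψ).conjTranspose * W * W.conjTranspose * jacobian M N ψ).map Complex.re := by
  ext i j
  rw [fisher_apply hσ, reInner_obsMeanDeriv, Matrix.smul_apply, Matrix.map_apply, smul_eq_mul]
  ring

/-! ### Cramér-Rao inequality in L² -/

/-- If the difference quotients `D t` of the likelihood converge to the score `S` in `L²`, the
covariance of an estimation error with the score is the derivative of the expectation. -/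
lemma integral_mul_eq_of_tendsto_sq {Ω : Type*} [MeasurableSpace Ω] {P : Measure Ω}
    {S : Ω → ℝ} {D : ℝ → Ω → ℝ} {ε : Ω → ℂ} {v : ℂ} {l : Filter ℝ} [l.NeBot]
    (hS : MemLp S 2 P) (hD : ∀ t, MemLp (D t) 2 P) (hε : MemLp ε 2 P)
    (hlim : Tendsto (fun t => ∫ x, (D t x - S x) ^ 2 ∂P) l (𝓝 0))
    (hv : Tendsto (fun t => ∫ x, (D t x : ℂ) * ε x ∂P) l (𝓝 v)) :
    ∫ x, (S x : ℂ) * ε x ∂P = v := by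
  refine tendsto_nhds_unique ?_ hv
  have hi : ∀ {f : Ω → ℝ}, MemLp f 2 P → Integrable (fun x => (f x : ℂ) * ε x) P := fun hf =>
    MemLp.integrable_mul (f := fun x => ((_ : ℝ) : ℂ)) hf.ofReal hε
  rw [tendsto_iff_norm_sub_tendsto_zero]
  -- By Cauchy-Schwarz the two pairings with ε differ by at most ‖D t - S‖₂ ‖ε‖₂.
  have hb : Tendsto (fun t => (∫ x, (D t x - S x) ^ 2 ∂P) ^ (1 / (2 : ℝ)) *
      (∫ x, ‖ε x‖ ^ (2 : ℝ) ∂P) ^ (1 / (2 : ℝ))) l (𝓝 0) := by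
    have h := (hlim.rpow_const (p := 1 / (2 : ℝ)) (Or.inr (by norm_num))).mul_const
      ((∫ x, ‖ε x‖ ^ (2 : ℝ) ∂P) ^ (1 / (2 : ℝ)))
    simpa [Real.zero_rpow] using h
  refine squeeze_zero (fun _ => norm_nonneg _) (fun t => ?_) hb
  rw [← integral_sub (hi (hD t)) (hi hS)]
  refine (norm_integral_le_integral_norm _).trans ?_
  have h2 : ENNReal.ofReal 2 = 2 := by simp
  have h := integral_mul_norm_le_Lp_mul_Lq (μ := P) (f := fun x => D t x - S x) (g := fun x => ‖ε x‖)
    (Real.HolderConjugate.two_two) (by rw [h2]; exact (hD t).sub hS) (by rw [h2]; exact hε.norm)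
  simp only [Real.norm_eq_abs, Real.rpow_two, sq_abs] at h ⊢
  refine le_trans (le_of_eq (integral_congr_ae (Eventually.of_forall fun x => ?_))) h
  simp only
  rw [← sub_mul, norm_mul, ← Complex.ofReal_sub, Complex.norm_real, Real.norm_eq_abs,
    abs_of_nonneg (norm_nonneg (ε x))]

/-- The quadratic lower bound of the second moment of a complex random variable by its
covariances with real ones. -/
lemma re_sum_le_integral_norm_sq {Ω : Type*} [MeasurableSpace Ω] {P : Measure Ω}
    {n : Type*} [Fintype n] {S : n → Ω → ℝ} {ε : Ω → ℂ} (hS : ∀ i, MemLp (S i) 2 P)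
    (hε : MemLp ε 2 P) (c : n → ℂ) :
    (∑ i, starRingEnd ℂ (c i) * (2 * ∫ x, (S i x : ℂ) * ε x ∂P -
      ∑ j, c j * ((∫ x, S i x * S j x ∂P : ℝ) : ℂ))).re ≤ ∫ x, ‖ε x‖ ^ 2 ∂P := by
  have h1 : ∀ i, Integrable (fun x => (S i x : ℂ) * ε x) P := fun i =>
    MemLp.integrable_mul (f := fun x => ((_ : ℝ) : ℂ)) (hS i).ofReal hε
  have h2 : ∀ i j, Integrable (fun x => ((S i x * S j x : ℝ) : ℂ)) P := fun i j =>
    ((hS i).integrable_mul (hS j)).ofReal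
  have h3 : ∀ i, Integrable (fun x => ∑ j, c j * ((S i x * S j x : ℝ) : ℂ)) P := fun i =>
    integrable_finsetSum _ fun j _ => (h2 i j).const_mul _
  have h4 : ∀ i, Integrable (fun x => starRingEnd ℂ (c i) * (2 * ((S i x : ℂ) * ε x) -
      ∑ j, c j * ((S i x * S j x : ℝ) : ℂ))) P := fun i =>
    (((h1 i).const_mul 2).sub (h3 i)).const_mul _
  have h5 : (∑ i, starRingEnd ℂ (c i) * (2 * ∫ x, (S i x : ℂ) * ε x ∂P -
      ∑ j, c j * ((∫ x, S i x * S j x ∂P : ℝ) : ℂ))) =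
      ∫ x, ∑ i, starRingEnd ℂ (c i) * (2 * ((S i x : ℂ) * ε x) -
        ∑ j, c j * ((S i x * S j x : ℝ) : ℂ)) ∂P := by
    rw [integral_finsetSum _ fun i _ => h4 i]
    refine Finset.sum_congr rfl fun i _ => ?_
    rw [integral_const_mul, integral_sub ((h1 i).const_mul 2) (h3 i), integral_const_mul,
      integral_finsetSum _ fun j _ => (h2 i j).const_mul _]
    simp only [integral_const_mul, integral_complex_ofReal]
  have h6 : Integrable (fun x => ∑ i, starRingEnd ℂ (c i) * (2 * ((S i x : ℂ) * ε x) -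
      ∑ j, c j * ((S i x * S j x : ℝ) : ℂ))) P := integrable_finsetSum _ fun i _ => h4 i
  have h7 : Integrable (fun x => ‖ε x‖ ^ 2) P := hε.norm.integrable_sq
  rw [h5, ← RCLike.re_eq_complex_re, ← integral_re h6]
  refine integral_mono h6.re h7 fun x => ?_
  simp only [RCLike.re_eq_complex_re]
  -- The integrands now compare pointwise: Re(Z̄(2ε - Z)) ≤ |ε|² is |ε - Z|² ≥ 0.
  set Z : ℂ := ∑ i, c i * (S i x : ℂ) with hZ
  have h8 : ∑ i, starRingEnd ℂ (c i) * (2 * ((S i x : ℂ) * ε x) -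
      ∑ j, c j * ((S i x * S j x : ℝ) : ℂ)) = starRingEnd ℂ Z * (2 * ε x - Z) := by
    rw [hZ, map_sum, Finset.sum_mul]
    refine Finset.sum_congr rfl fun i _ => ?_
    rw [map_mul, Complex.conj_ofReal, mul_assoc, mul_sub (S i x : ℂ), Finset.mul_sum]
    congr 2
    · ring
    · refine Finset.sum_congr rfl fun j _ => ?_
      push_cast
      ring
  rw [h8, Complex.sq_norm, Complex.normSq_apply]
  simp only [Complex.mul_re, Complex.sub_re, Complex.sub_im, Complex.conj_re, Complex.conj_im,
    Complex.mul_im, Complex.re_ofNat, Complex.im_ofNat]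
  nlinarith [sq_nonneg ((ε x).re - Z.re), sq_nonneg ((ε x).im - Z.im)]

/-! ### Differentiability of the likelihood in L² -/

section

variable {κ ι : Type*} [Fintype κ] [Fintype ι]

/-- The difference quotients of the likelihood ratio along a differentiable curve of means
converge in `L²` to a linear functional of the noise. -/
lemma tendsto_integral_likelihoodRatio_quotient_sub_sq {σ : ℝ} (hσ : 0 < σ) {m : ℝ → κ → ι → ℂ}
    {c : κ → ι → ℂ} (hm : HasDerivAt m c 0) :
    Tendsto (fun t : ℝ => ∫ y, (t⁻¹ * (likelihoodRatio σ (m 0) (m t - m 0) y - 1) -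
      2 / σ ^ 2 * reInner₂ c (y - m 0)) ^ 2 ∂arrayNormal σ (m 0)) (𝓝[≠] 0) (𝓝 0) := by
  have hP := isProbabilityMeasure_arrayNormal hσ (m 0)
  have hslope : Tendsto (fun t : ℝ => t⁻¹ • (m t - m 0)) (𝓝[≠] 0) (𝓝 c) := by
    simpa using hm.tendsto_slope_zero
  have hΔ : Tendsto (fun t : ℝ => m t - m 0) (𝓝[≠] 0) (𝓝 0) := by
    have := (hm.continuousAt.tendsto.sub_const (m 0)).mono_left
      (nhdsWithin_le_nhds (s := {0}ᶜ))
    simpa using this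
  have hsr : ∀ (a : ℝ) (c d : κ → ι → ℂ), reInner₂ c (a • d) = a * reInner₂ c d := by
    intro a c d
    simp [reInner₂, reInner, Finset.mul_sum, mul_left_comm]
  have hq : Tendsto (fun t : ℝ => 2 * reInner₂ (m t - m 0) (m t - m 0) / σ ^ 2)
      (𝓝[≠] 0) (𝓝 0) := by
    have := (((continuous_reInner₂.tendsto ((0 : κ → ι → ℂ), (0 : κ → ι → ℂ))).comp
      (hΔ.prodMk_nhds hΔ)).const_mul 2).div_const (σ ^ 2)
    have h0 : reInner₂ (0 : κ → ι → ℂ) 0 = 0 := by simp [reInner₂, reInner]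
    simpa only [Function.comp_def, h0, mul_zero, zero_div] using this
  have hq' : Tendsto (fun t : ℝ => t⁻¹ ^ 2 * (2 * reInner₂ (m t - m 0) (m t - m 0) / σ ^ 2))
      (𝓝[≠] 0) (𝓝 (2 * reInner₂ c c / σ ^ 2)) := by
    have := (((continuous_reInner₂.tendsto (c, c)).comp
      (hslope.prodMk_nhds hslope)).const_mul 2).div_const (σ ^ 2)
    refine this.congr fun t => ?_
    simp only [Function.comp_apply, hsr]
    rw [reInner₂_comm, hsr]
    ring
  have hl : Tendsto (fun t : ℝ => t⁻¹ * reInner₂ c (m t - m 0)) (𝓝[≠] 0)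
      (𝓝 (reInner₂ c c)) := by
    have := (continuous_reInner₂.tendsto (c, c)).comp (tendsto_const_nhds.prodMk_nhds hslope)
    refine this.congr fun t => ?_
    simp only [Function.comp_apply, hsr]
  have hexp : Tendsto (fun t : ℝ => t⁻¹ ^ 2 *
      (Real.exp (2 * reInner₂ (m t - m 0) (m t - m 0) / σ ^ 2) - 1)) (𝓝[≠] 0)
      (𝓝 (2 * reInner₂ c c / σ ^ 2)) := by
    -- Writing exp u - 1 = u · `dslope Real.exp 0 u` avoids a division by u, which may vanish for t
    -- ≠ 0.
    have hd : Tendsto (dslope Real.exp 0) (𝓝 0) (𝓝 1) := by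
      have := (continuousAt_dslope_same.2 (Real.differentiableAt_exp (x := 0))).tendsto
      simpa using this
    have := hq'.mul (hd.comp hq)
    rw [mul_one] at this
    refine this.congr fun t => ?_
    have h := sub_smul_dslope Real.exp 0 (2 * reInner₂ (m t - m 0) (m t - m 0) / σ ^ 2)
    rw [sub_zero, Real.exp_zero, smul_eq_mul] at h
    rw [← h, Function.comp_apply]
    ring
  -- Expanding the square leaves only explicit moments: those of the ratio, of the noise functional,
  -- and of their product.
  have hval : ∀ t : ℝ, ∫ y, (t⁻¹ * (likelihoodRatio σ (m 0) (m t - m 0) y - 1) -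
      2 / σ ^ 2 * reInner₂ c (y - m 0)) ^ 2 ∂arrayNormal σ (m 0) =
      t⁻¹ ^ 2 * (Real.exp (2 * reInner₂ (m t - m 0) (m t - m 0) / σ ^ 2) - 1) -
        4 / σ ^ 2 * (t⁻¹ * reInner₂ c (m t - m 0)) + 2 / σ ^ 2 * reInner₂ c c := by
    intro t
    have hL := memLp_likelihoodRatio hσ (m 0) (m t - m 0)
    have hT := memLp_reInner₂_arrayNormal hσ (m 0) c
    have e : ∀ y, (t⁻¹ * (likelihoodRatio σ (m 0) (m t - m 0) y - 1) -
        2 / σ ^ 2 * reInner₂ c (y - m 0)) ^ 2 =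
        t⁻¹ ^ 2 * (likelihoodRatio σ (m 0) (m t - m 0) y ^ 2) -
        2 * t⁻¹ ^ 2 * likelihoodRatio σ (m 0) (m t - m 0) y + t⁻¹ ^ 2 -
        4 / σ ^ 2 * t⁻¹ * (likelihoodRatio σ (m 0) (m t - m 0) y * reInner₂ c (y - m 0)) +
        4 / σ ^ 2 * t⁻¹ * reInner₂ c (y - m 0) +
        (2 / σ ^ 2) ^ 2 * (reInner₂ c (y - m 0) * reInner₂ c (y - m 0)) := fun y => by ring
    have i1 := hL.integrable_sq.const_mul (t⁻¹ ^ 2)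
    have i2 := (hL.integrable (by norm_num)).const_mul (2 * t⁻¹ ^ 2)
    have i3 : Integrable (fun _ => t⁻¹ ^ 2) (arrayNormal σ (m 0)) := integrable_const _
    have i4 := (hL.integrable_mul hT).const_mul (4 / σ ^ 2 * t⁻¹)
    have i5 := (hT.integrable (by norm_num)).const_mul (4 / σ ^ 2 * t⁻¹)
    have i6 := (hT.integrable_mul hT).const_mul ((2 / σ ^ 2) ^ 2)
    simp only [Pi.mul_apply] at i4 i6
    simp only [e]
    rw [integral_add ((((i1.sub' i2).fun_add i3).sub' i4).fun_add i5) i6,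
      integral_add (((i1.sub' i2).fun_add i3).sub' i4) i5,
      integral_sub ((i1.sub' i2).fun_add i3) i4, integral_add (i1.sub' i2) i3, integral_sub i1 i2]
    simp only [integral_const_mul]
    rw [integral_likelihoodRatio_sq hσ, integral_likelihoodRatio hσ,
      integral_likelihoodRatio_mul hσ, integral_reInner₂_mul_arrayNormal hσ,
      integral_eq_zero_of_map_gaussianReal (measurable_reInner₂ _ _)
        (map_reInner₂_arrayNormal hσ (m 0) c)]
    simp
    field_simp
    ring
  simp only [hval]
  -- In units of |c|²/σ² the three limits are 2, -4 and 2, and they cancel.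
  have := (hexp.sub (hl.const_mul (4 / σ ^ 2))).add_const (2 / σ ^ 2 * reInner₂ c c)
  convert! this using 2
  ring

end

/-! ### The Cramér-Rao bound for the channel -/

/-- The score of the joint law. -/
noncomputable def jointScore (r σ : ℝ) (W : Fin k → Matrix (Fin M × Fin N) (Fin q) ℂ)
    (ψ : Param) (i : Fin 4) (y : Fin k → Fin q → ℂ) : ℝ :=
  2 / σ ^ 2 * reInner₂ (fun l => obsMeanDeriv r (W l) ψ i) (y - fun l => obsMean r (W l) ψ)

lemma memLp_jointScore {σ : ℝ} (hσ : 0 < σ) (r : ℝ)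
    (W : Fin k → Matrix (Fin M × Fin N) (Fin q) ℂ) (ψ : Param) (i : Fin 4) :
    MemLp (jointScore r σ W ψ i) 2 (jointLaw r σ W ψ) := by
  rw [jointLaw_eq_arrayNormal hσ]
  exact (memLp_reInner₂_arrayNormal hσ _ _).const_mul _

/-- The Fisher information matrices of independent observations add up. -/
lemma integral_jointScore_mul {σ : ℝ} (hσ : 0 < σ) (r : ℝ)
    (W : Fin k → Matrix (Fin M × Fin N) (Fin q) ℂ) (ψ : Param) (i j : Fin 4) :
    ∫ y, jointScore r σ W ψ i y * jointScore r σ W ψ j y ∂jointLaw r σ W ψ =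
      (∑ l, fisher r σ (W l) ψ) i j := by
  rw [jointLaw_eq_arrayNormal hσ, Matrix.sum_apply]
  simp only [fisher_apply hσ, jointScore, mul_mul_mul_comm (2 / σ ^ 2)]
  rw [integral_const_mul, integral_reInner₂_mul_arrayNormal hσ, ← Finset.mul_sum]
  change _ = 2 / σ ^ 2 * reInner₂ _ _
  field_simp

/-- The covariance of an unbiased estimate with the score is the Jacobian matrix. -/
lemma integral_jointScore_mul_error {σ : ℝ} (hσ : 0 < σ) (r : ℝ)
    (W : Fin k → Matrix (Fin M × Fin N) (Fin q) ℂ) (ψ : Param)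
    {g : (Fin k → Fin q → ℂ) → Fin M × Fin N → ℂ}
    (hg : ∀ᶠ φ in 𝓝 ψ, UnbiasedAt r σ W g φ) (p : Fin M × Fin N)
    (hp : MemLp (fun y => g y p - channel M N ψ p) 2 (jointLaw r σ W ψ)) (i : Fin 4) :
    ∫ y, (jointScore r σ W ψ i y : ℂ) * (g y p - channel M N ψ p) ∂jointLaw r σ W ψ =
      jacobian M N ψ p i := by
  set γ : ℝ → Param := fun t => ψ + t • Pi.single i 1 with hγ
  have hγ0 : γ 0 = ψ := by simp [hγ]
  set m : ℝ → Fin k → Fin q → ℂ := fun t l => obsMean r (W l) (γ t) with hm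
  have hlaw : ∀ t, jointLaw r σ W (γ t) = arrayNormal σ (m t) := fun t =>
    jointLaw_eq_arrayNormal hσ r W (γ t)
  have hlaw0 : jointLaw r σ W ψ = arrayNormal σ (m 0) := by rw [← hlaw, hγ0]
  have hderiv : HasDerivAt m (fun l => obsMeanDeriv r (W l) ψ i) 0 :=
    hasDerivAt_pi.2 fun l => hasDerivAt_obsMean_line r (W l) ψ i
  have hP := isProbabilityMeasure_arrayNormal hσ (m 0)
  have hunb : ∀ᶠ t in 𝓝[≠] (0 : ℝ), UnbiasedAt r σ W g (γ t) := by
    have hc : Tendsto γ (𝓝 0) (𝓝 ψ) := by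
      have : Continuous γ := by fun_prop
      simpa only [hγ0] using this.tendsto 0
    exact (hc.mono_left nhdsWithin_le_nhds).eventually hg
  have hunb0 : ∫ y, g y p ∂arrayNormal σ (m 0) = channel M N ψ p := by
    rw [← hlaw0]; exact (hg.self_of_nhds p).2
  have hint0 : Integrable (fun y => g y p) (arrayNormal σ (m 0)) := by
    rw [← hlaw0]; exact (hg.self_of_nhds p).1
  rw [hlaw0] at hp ⊢
  -- Square integrability under ψ alone suffices: the ratio is also in L², so its product with the
  -- estimate is integrable.
  have hgL : MemLp (fun y => g y p) 2 (arrayNormal σ (m 0)) := by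
    simpa [Pi.add_def] using hp.add (memLp_const (channel M N ψ p))
  have hL := fun t => memLp_likelihoodRatio hσ (m 0) (m t - m 0)
  have hS := memLp_jointScore hσ r W ψ i
  rw [hlaw0] at hS
  refine integral_mul_eq_of_tendsto_sq (l := 𝓝[≠] 0)
    (D := fun t y => t⁻¹ * (likelihoodRatio σ (m 0) (m t - m 0) y - 1)) hS
    (fun t => ((hL t).sub (memLp_const 1)).const_mul _) hp ?_ ?_
  · have h := tendsto_integral_likelihoodRatio_quotient_sub_sq hσ hderiv
    simpa only [jointScore, hm, hγ0] using h
  · have h := (hasDerivAt_channel_line M N ψ i p).tendsto_slope_zero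
    refine h.congr' ?_
    filter_upwards [hunb] with t ht
    have hLg : Integrable (fun y => (likelihoodRatio σ (m 0) (m t - m 0) y : ℂ) * g y p)
        (arrayNormal σ (m 0)) :=
      MemLp.integrable_mul (f := fun y => ((_ : ℝ) : ℂ)) (hL t).ofReal hgL
    have hLc : Integrable (fun y => (likelihoodRatio σ (m 0) (m t - m 0) y : ℂ) *
        channel M N ψ p) (arrayNormal σ (m 0)) :=
      (((hL t).integrable (by norm_num)).ofReal).mul_const _
    have h1 : ∫ y, (likelihoodRatio σ (m 0) (m t - m 0) y : ℂ) * g y p ∂arrayNormal σ (m 0) =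
        channel M N (γ t) p := by
      rw [← (ht p).2, hlaw, ← add_sub_cancel (m 0) (m t), integral_arrayNormal_add hσ]
      simp
    -- Since E[L_t] = 1 and E[g] = h(ψ), only E[L_t g] - h(ψ) survives; by unbiasedness at the
    -- shifted parameter it equals h(ψ + t e_i) - h(ψ).
    have e : ∀ y, ((t⁻¹ * (likelihoodRatio σ (m 0) (m t - m 0) y - 1) : ℝ) : ℂ) *
        (g y p - channel M N ψ p) = (t : ℂ)⁻¹ *
          ((likelihoodRatio σ (m 0) (m t - m 0) y : ℂ) * g y p -
            (likelihoodRatio σ (m 0) (m t - m 0) y : ℂ) * channel M N ψ p -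
            (g y p - channel M N ψ p)) := by
      intro y
      push_cast
      ring
    simp only [e]
    rw [integral_const_mul, integral_sub (hLg.sub' hLc) (hint0.sub' (integrable_const _)),
      integral_sub hLg hLc, integral_sub hint0 (integrable_const _), h1, integral_mul_const,
      integral_complex_ofReal, integral_likelihoodRatio hσ, hunb0]
    simp [hγ]

lemma fisher_transpose {σ : ℝ} (hσ : 0 < σ) (r : ℝ) (W : Matrix (Fin M × Fin N) (Fin q) ℂ)
    (ψ : Param) : (fisher r σ W ψ).transpose = fisher r σ W ψ := by
  ext i j
  rw [Matrix.transpose_apply, fisher_apply hσ, fisher_apply hσ, reInner_comm]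

/-- Splits the bound into one quadratic form per channel entry, so that the inequality can be proved
entry by entry. -/
lemma trace_map_mul_conjTranspose_mul {n ρ : Type*} [Fintype n] [Fintype ρ]
    (K : Matrix n n ℝ) (V : Matrix ρ n ℂ) :
    Matrix.trace (K.map Complex.ofReal * (V.conjTranspose * V)) =
      ∑ p, ∑ i, (∑ j, (K i j : ℂ) * starRingEnd ℂ (V p j)) * V p i := by
  simp only [Matrix.trace, Matrix.diag_apply, Matrix.mul_apply, Matrix.map_apply,
    Matrix.conjTranspose_apply, Finset.mul_sum, Finset.sum_mul]
  rw [Finset.sum_comm (γ := ρ)]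
  refine Finset.sum_congr rfl fun i _ => ?_
  rw [Finset.sum_comm (γ := ρ)]
  refine Finset.sum_congr rfl fun j _ => Finset.sum_congr rfl fun p _ => ?_
  rw [mul_assoc]
  rfl

/-- The Cramér-Rao bound for one entry of the channel vector. -/
lemma re_sum_le_integral_error_sq {σ : ℝ} (hσ : 0 < σ) (r : ℝ)
    (W : Fin k → Matrix (Fin M × Fin N) (Fin q) ℂ) (ψ : Param)
    (hJ : IsUnit (∑ l, fisher r σ (W l) ψ).det)
    {g : (Fin k → Fin q → ℂ) → Fin M × Fin N → ℂ}
    (hg : ∀ᶠ φ in 𝓝 ψ, UnbiasedAt r σ W g φ) (p : Fin M × Fin N)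
    (hp : MemLp (fun y => g y p - channel M N ψ p) 2 (jointLaw r σ W ψ)) :
    (∑ i, (∑ j, (((∑ l, fisher r σ (W l) ψ)⁻¹ i j : ℝ) : ℂ) *
      starRingEnd ℂ (jacobian M N ψ p j)) * jacobian M N ψ p i).re ≤
      ∫ y, ‖g y p - channel M N ψ p‖ ^ 2 ∂jointLaw r σ W ψ := by
  set J := ∑ l, fisher r σ (W l) ψ with hJdef
  -- The optimal coefficients solve J c = V_p; then 2 V_p - J c reduces to V_p.
  set c : Fin 4 → ℂ := (J⁻¹.map Complex.ofReal).mulVec fun j => jacobian M N ψ p j with hc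
  have h := re_sum_le_integral_norm_sq (fun i => memLp_jointScore hσ r W ψ i) hp c
  simp only [integral_jointScore_mul_error hσ r W ψ hg p hp, integral_jointScore_mul hσ,
    ← hJdef] at h
  refine le_trans (le_of_eq ?_) h
  have hJc : ∀ i, ∑ j, c j * (J i j : ℂ) = jacobian M N ψ p i := by
    intro i
    have h0 : J.map Complex.ofReal * J⁻¹.map Complex.ofReal = 1 := by
      have h := (Matrix.map_mul (L := J) (M := J⁻¹) (f := Complex.ofRealHom)).symm
      rw [Matrix.mul_nonsing_inv _ hJ] at h
      exact h.trans (Matrix.map_one _ (map_zero _) (map_one _))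
    have h1 : (J.map Complex.ofReal).mulVec c = fun j => jacobian M N ψ p j := by
      rw [hc, Matrix.mulVec_mulVec, h0, Matrix.one_mulVec]
    rw [← (congrFun h1 i :)]
    exact Finset.sum_congr rfl fun j _ => mul_comm _ _
  congr 1
  refine Finset.sum_congr rfl fun i _ => ?_
  rw [hJc, two_mul, add_sub_cancel_right]
  congr 1
  simp [hc, Matrix.mulVec, dotProduct]

/-- The inverse of the symmetric real Fisher sum is symmetric, so conjugating its quadratic form at
a row of V only swaps the two summation indices. -/
lemma im_crlb {σ : ℝ} (hσ : 0 < σ) (r : ℝ)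
    (W : Fin k → Matrix (Fin M × Fin N) (Fin q) ℂ) (ψ : Param) :
    (crlb r σ W ψ).im = 0 := by
  have hs : ∀ i j, (∑ l, fisher r σ (W l) ψ)⁻¹ i j = (∑ l, fisher r σ (W l) ψ)⁻¹ j i := by
    intro i j
    rw [← Matrix.transpose_apply (_)⁻¹ i j, Matrix.transpose_nonsing_inv, Matrix.transpose_sum]
    simp only [fisher_transpose hσ]
  rw [← Complex.conj_eq_iff_im, crlb, trace_map_mul_conjTranspose_mul]
  simp only [map_mul, map_div₀, map_one, map_natCast, map_sum, Complex.conj_ofReal,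
    Complex.conj_conj, Finset.sum_mul]
  congr 1
  refine Finset.sum_congr rfl fun p _ => ?_
  rw [Finset.sum_comm]
  refine Finset.sum_congr rfl fun i _ => Finset.sum_congr rfl fun j _ => ?_
  rw [hs j i]
  ring

lemma ofReal_re_crlb_le_mse {σ : ℝ} (hM : 0 < M) (hN : 0 < N) (hσ : 0 < σ) (r : ℝ)
    (W : Fin k → Matrix (Fin M × Fin N) (Fin q) ℂ) (ψ : Param)
    (hJ : IsUnit (∑ l, fisher r σ (W l) ψ).det)
    {g : (Fin k → Fin q → ℂ) → Fin M × Fin N → ℂ}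
    (hg : ∀ᶠ φ in 𝓝 ψ, UnbiasedAt r σ W g φ) :
    ENNReal.ofReal (crlb r σ W ψ).re ≤ mse r σ W g ψ := by
  have hpos : 0 < 1 / ((M : ℝ) * (N : ℝ)) := by positivity
  have hlaw : IsProbabilityMeasure (jointLaw r σ W ψ) := by
    rw [jointLaw_eq_arrayNormal hσ]; exact isProbabilityMeasure_arrayNormal hσ _
  have hmeas : ∀ p, AEStronglyMeasurable (fun y => g y p - channel M N ψ p)
      (jointLaw r σ W ψ) := fun p =>
    ((hg.self_of_nhds p).1.sub (integrable_const _)).aestronglyMeasurable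
  have hmeas2 : ∀ p, AEStronglyMeasurable (fun y => ‖g y p - channel M N ψ p‖ ^ 2)
      (jointLaw r σ W ψ) := fun p => (hmeas p).norm.pow 2
  -- A finite total error dominates each squared entry, which puts every entry of the error in L² as
  -- the entrywise bound requires.
  by_cases htop : ∫⁻ y, ENNReal.ofReal (∑ p, ‖g y p - channel M N ψ p‖ ^ 2)
      ∂jointLaw r σ W ψ = ⊤
  · rw [mse, htop, ENNReal.mul_top (ENNReal.ofReal_pos.2 hpos).ne']
    exact le_top
  have hsum : Integrable (fun y => ∑ p, ‖g y p - channel M N ψ p‖ ^ 2) (jointLaw r σ W ψ) :=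
    (lintegral_ofReal_ne_top_iff_integrable
      (Finset.aestronglyMeasurable_fun_sum _ fun p _ => hmeas2 p)
      (Eventually.of_forall fun y => by positivity)).1 htop
  have hint : ∀ p, Integrable (fun y => ‖g y p - channel M N ψ p‖ ^ 2) (jointLaw r σ W ψ) := by
    intro p
    refine hsum.mono' (hmeas2 p) (Eventually.of_forall fun y => ?_)
    rw [Real.norm_of_nonneg (by positivity)]
    exact Finset.single_le_sum (f := fun p => ‖g y p - channel M N ψ p‖ ^ 2)
      (fun p _ => by positivity) (Finset.mem_univ p)
  have hLp : ∀ p, MemLp (fun y => g y p - channel M N ψ p) 2 (jointLaw r σ W ψ) := fun p =>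
    (memLp_two_iff_integrable_sq_norm (hmeas p)).2 (hint p)
  rw [mse, ← ofReal_integral_eq_lintegral_ofReal hsum
    (Eventually.of_forall fun y => by positivity), ← ENNReal.ofReal_mul hpos.le,
    integral_finsetSum _ fun p _ => hint p]
  refine ENNReal.ofReal_le_ofReal ?_
  have hc : (1 / ((M : ℂ) * (N : ℂ))) = ((1 / ((M : ℝ) * (N : ℝ)) : ℝ) : ℂ) := by push_cast; rfl
  rw [crlb, trace_map_mul_conjTranspose_mul, hc, Complex.re_ofReal_mul, Complex.re_sum]
  exact mul_le_mul_of_nonneg_left (Finset.sum_le_sum fun p _ =>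
    re_sum_le_integral_error_sq hσ r W ψ hJ hg p (hLp p)) hpos.le

end BeamTracking

theorem lemma2 {M N q L : ℕ} (hM : 0 < M) (hN : 0 < N)
    (s : EuclideanSpace ℂ (Fin L)) (σ : ℝ) (hσ : 0 < σ) (ψ : BeamTracking.Param) :
    -- the Jacobian matrix
    (BeamTracking.jacobian M N ψ = Matrix.of fun p =>
      ![BeamTracking.steering M N (ψ 2) (ψ 3) p,
        Complex.I * BeamTracking.steering M N (ψ 2) (ψ 3) p,
        BeamTracking.gain ψ * deriv (fun t : ℝ => BeamTracking.steering M N t (ψ 3) p) (ψ 2),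
        BeamTracking.gain ψ * deriv (fun t : ℝ => BeamTracking.steering M N (ψ 2) t p) (ψ 3)]) ∧
    -- the Fisher information matrix
    (∀ W : Matrix (Fin M × Fin N) (Fin q) ℂ,
      (∀ i j, MeasureTheory.Integrable
        (fun y => BeamTracking.score ‖s‖ σ W ψ y i * BeamTracking.score ‖s‖ σ W ψ y j)
        (BeamTracking.obsLaw ‖s‖ σ W ψ)) ∧
      BeamTracking.fisher ‖s‖ σ W ψ = (2 * ‖s‖ ^ 2 / σ ^ 2) •
        ((BeamTracking.jacobian M N ψ).conjTranspose * W * W.conjTranspose *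
          BeamTracking.jacobian M N ψ).map Complex.re) ∧
    -- the lower bound of the mean square error
    (∀ (k : ℕ) (W : Fin k → Matrix (Fin M × Fin N) (Fin q) ℂ),
      IsUnit (∑ l, BeamTracking.fisher ‖s‖ σ (W l) ψ).det →
      (BeamTracking.crlb ‖s‖ σ W ψ).im = 0 ∧
      ∀ g : (Fin k → Fin q → ℂ) → Fin M × Fin N → ℂ,
        (∀ᶠ φ in nhds ψ, BeamTracking.UnbiasedAt ‖s‖ σ W g φ) →
        ENNReal.ofReal (BeamTracking.crlb ‖s‖ σ W ψ).re ≤ BeamTracking.mse ‖s‖ σ W g ψ) := by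
  exact ⟨BeamTracking.jacobian_eq M N ψ,
    fun W => ⟨BeamTracking.integrable_score_mul hσ ‖s‖ W ψ, BeamTracking.fisher_eq hσ ‖s‖ W ψ⟩,
    fun k W hJ => ⟨BeamTracking.im_crlb hσ ‖s‖ W ψ, fun g hg =>
      BeamTracking.ofReal_re_crlb_le_mse hM hN hσ ‖s‖ W ψ hJ hg⟩⟩
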